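/- Let $S_n$ be the symmetric group on $\{1,\dots,n\}$ and let $T_n\subseteq S_n$ be the set of $321$-avoiding permutations, i.e. those having no decreasing subsequence of length three. An integer $i$ with $1\le i\le n-1$ is a descent of $\pi\in S_n$ if $\pi_i>\pi_{i+1}$; let $\mathsf{ldes}(\pi)$ be the largest descent of $\pi$, with $\mathsf{ldes}(\mathrm{id})=0$, and let $\mathsf{sign}(\pi)\in\{1,-1\}$ be the sign of $\pi$. Then for all $n\ge 1$ the following identities hold in $\mathbb{Z}[q]$: $$\sum_{\pi\in T_{2n+1}}\mathsf{sign}(\pi)\,q^{\mathsf{ldes}(\pi)}=\sum_{\pi\in T_n}q^{2\,\mathsf{ldes}(\pi)},\qquad \sum_{\pi\in T_{2n}}\mathsf{sign}(\pi)\,q^{\mathsf{ldes}(\pi)}=(1-q)\sum_{\pi\in T_n}q^{2\,\mathsf{ldes}(\pi)}.$$ -/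

import Mathlib

namespace SignBalance

/-- A permutation is `321`-avoiding if it has no decreasing subsequence of length three. -/
def Avoids321 {n : ℕ} (π : Equiv.Perm (Fin n)) : Prop :=
  ∀ i j k : Fin n, i < j → j < k → ¬ (π j < π i ∧ π k < π j)

instance {n : ℕ} (π : Equiv.Perm (Fin n)) : Decidable (Avoids321 π) := by
  unfold Avoids321
  infer_instance

/-- The set of `321`-avoiding permutations in the symmetric group on `n` letters. -/
def T (n : ℕ) : Finset (Equiv.Perm (Fin n)) :=
  Finset.univ.filter Avoids321

/-- `i` is a descent of `π`, in the usual one-based numbering of positions: `π_i > π_{i+1}`.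
The `i`-th position is the element `a` of `Fin n` with `a + 1 = i`. -/
def IsDescent {n : ℕ} (π : Equiv.Perm (Fin n)) (i : ℕ) : Prop :=
  ∃ a b : Fin n, a.val + 1 = i ∧ b.val + 1 = i + 1 ∧ π b < π a

instance {n : ℕ} (π : Equiv.Perm (Fin n)) (i : ℕ) : Decidable (IsDescent π i) := by
  unfold IsDescent
  infer_instance

/-- The descent set of `π`. Every descent of `π` is smaller than `n`. -/
def descents {n : ℕ} (π : Equiv.Perm (Fin n)) : Finset ℕ :=
  (Finset.range n).filter (IsDescent π)

/-- The last (greatest) descent of `π`; it is `0` if `π` has no descent. -/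
def ldes {n : ℕ} (π : Equiv.Perm (Fin n)) : ℕ :=
  (descents π).sup id

end SignBalance

namespace SignBalance

open Finset

variable {n : ℕ}

/-! Build permutations by inserting a new largest letter at 0-based position `j`. Avoidance survives
exactly when `j` is at least the last descent (`avoids321_insertMax`); the last descent becomes `j +
1`, or is unchanged if the letter goes at the end. The sign changes by `(-1) ^ (n + j)`. This gives
one recurrence, `weight_succ`, for both plain and signed counts by last descent. Two signed steps
amount to one plain step: at odd length the signed counts live on even descents, and at even length
they come in opposite pairs that cancel in prefix sums. -/

theorem ldes_le_iff (π : Equiv.Perm (Fin n)) (k : ℕ) :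
    ldes π ≤ k ↔ ∀ a b : Fin n, k ≤ a.val → b.val = a.val + 1 → π a < π b := by
  unfold ldes
  rw [Finset.sup_le_iff]
  constructor
  · intro h a b hka hab
    by_contra hlt
    have hne : π b ≠ π a := fun he => by
      have := congrArg Fin.val (π.injective he)
      omega
    have hd : a.val + 1 ∈ descents π := by
      simp only [descents, mem_filter, mem_range]
      exact ⟨by omega, a, b, rfl, by omega, lt_of_le_of_ne (not_lt.mp hlt) hne⟩
    have := h _ hd
    simp only [id] at this
    omega
  · intro h i hi
    simp only [descents, mem_filter, mem_range] at hi
    obtain ⟨-, a, b, ha, hb, hlt⟩ := hi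
    by_contra hk
    simp only [id] at hk
    exact lt_asymm hlt (h a b (by omega) (by omega))

theorem ldes_le_iff_lt (π : Equiv.Perm (Fin n)) (k : ℕ) :
    ldes π ≤ k ↔ ∀ a b : Fin n, k ≤ a.val → a < b → π a < π b := by
  rw [ldes_le_iff]
  constructor
  · intro h a b hka hab
    have key : ∀ d : ℕ, ∀ b : Fin n, b.val = a.val + 1 + d → π a < π b := by
      intro d
      induction d with
      | zero => exact fun b hb => h a b hka hb
      | succ d ih =>
        intro b hb
        let c : Fin n := ⟨a.val + 1 + d, by omega⟩
        exact (ih c rfl).trans (h c b (by simp only [c]; omega) (by simp only [c]; omega))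
    exact key (b.val - a.val - 1) b (by have : a.val < b.val := hab; omega)
  · intro h a b hka hab
    exact h a b hka (Fin.lt_def.mpr (by omega))

theorem ldes_lt_succ (π : Equiv.Perm (Fin (n + 1))) : ldes π ≤ n := by
  rw [ldes_le_iff]
  intro a b ha hb
  omega

/-! ### Inserting the largest letter -/

/-- Insert a new largest letter into `σ` at position `j`. -/
def insertMax (σ : Equiv.Perm (Fin n)) (j : Fin (n + 1)) : Equiv.Perm (Fin (n + 1)) :=
  ((finSuccEquiv' j).trans (Equiv.optionCongr σ)).trans (finSuccEquiv' (Fin.last n)).symm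

@[simp]
theorem insertMax_self (σ : Equiv.Perm (Fin n)) (j : Fin (n + 1)) :
    insertMax σ j j = Fin.last n := by
  simp [insertMax]

@[simp]
theorem insertMax_succAbove (σ : Equiv.Perm (Fin n)) (j : Fin (n + 1)) (i : Fin n) :
    insertMax σ j (j.succAbove i) = (σ i).castSucc := by
  simp [insertMax]

/-- Insertion at `j` is insertion at the end preceded by the cycle moving `j` to the last position;
that cycle is a quotient of two `cycleRange`s, of signs `(-1) ^ n` and `(-1) ^ j`. -/
theorem sign_insertMax (σ : Equiv.Perm (Fin n)) (j : Fin (n + 1)) :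
    Equiv.Perm.sign (insertMax σ j) = (-1) ^ (n + j.val) * Equiv.Perm.sign σ := by
  have h : insertMax σ j =
      ((finSuccEquiv' (Fin.last n)).trans (Equiv.optionCongr σ)).trans
        (finSuccEquiv' (Fin.last n)).symm * ((Fin.last n).cycleRange⁻¹ * j.cycleRange) := by
    ext x
    refine Fin.succAboveCases j ?_ (fun i => ?_) x
    · have : (Fin.last n).cycleRange⁻¹ 0 = Fin.last n := by
        rw [Equiv.Perm.inv_eq_iff_eq, Fin.cycleRange_self]
      rw [Equiv.Perm.mul_apply, Equiv.Perm.mul_apply, Fin.cycleRange_self, this]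
      simp
    · have : (Fin.last n).cycleRange⁻¹ i.succ = i.castSucc := by
        rw [Equiv.Perm.inv_eq_iff_eq, ← Fin.succAbove_last_apply, Fin.cycleRange_succAbove]
      rw [Equiv.Perm.mul_apply, Equiv.Perm.mul_apply, Fin.cycleRange_succAbove, this,
        ← Fin.succAbove_last_apply, insertMax_succAbove]
      exact congrArg Fin.val (insertMax_succAbove σ (Fin.last n) i).symm
  rw [h, Equiv.Perm.sign_mul, Equiv.Perm.sign_mul, Equiv.Perm.sign_inv, Fin.sign_cycleRange,
    Fin.sign_cycleRange, Equiv.Perm.sign_trans_trans_symm, Equiv.optionCongr_sign, pow_add,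
    Fin.val_last, mul_comm]

theorem insertMax_bijective :
    Function.Bijective (fun p : Equiv.Perm (Fin n) × Fin (n + 1) => insertMax p.1 p.2) := by
  rw [Fintype.bijective_iff_injective_and_card]
  constructor
  · rintro ⟨σ, j⟩ ⟨τ, k⟩ h
    simp only at h
    have hjk : j = k := by
      apply (insertMax τ k).injective
      rw [insertMax_self, ← h, insertMax_self]
    subst hjk
    have : σ = τ := by
      ext i
      have := congrArg (fun π => π (j.succAbove i)) h
      simpa [Fin.ext_iff] using this
    rw [this]
  · simp [Fintype.card_perm, Nat.factorial_succ, mul_comm]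

/-- The new letter can only be the "3" of a pattern, so it is harmless exactly when the letters to
its right increase. -/
theorem avoids321_insertMax (σ : Equiv.Perm (Fin n)) (j : Fin (n + 1)) :
    Avoids321 (insertMax σ j) ↔ Avoids321 σ ∧ ldes σ ≤ j.val := by
  rw [ldes_le_iff_lt]
  constructor
  · refine fun h => ⟨fun a b c hab hbc hd => ?_, fun a b hja hab => ?_⟩
    · refine h (j.succAbove a) (j.succAbove b) (j.succAbove c) (by simpa) (by simpa) ?_
      simpa using hd
    · by_contra hlt
      have hne : σ b ≠ σ a := fun he => hab.ne' (σ.injective he)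
      refine h j (j.succAbove a) (j.succAbove b) ?_ (by simpa) ⟨?_, ?_⟩
      · rw [Fin.lt_succAbove_iff_le_castSucc]
        exact hja
      · simp [Fin.castSucc_lt_last]
      · simpa using lt_of_le_of_ne (not_lt.mp hlt) hne
  · rintro ⟨h, hm⟩ a b c hab hbc ⟨hba, hcb⟩
    induction b using Fin.succAboveCases j with
    | x => rw [insertMax_self] at hba; exact absurd hba (Fin.le_last _).not_gt
    | p b =>
      induction c using Fin.succAboveCases j with
      | x => rw [insertMax_self] at hcb; exact absurd hcb (Fin.le_last _).not_gt
      | p c =>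
        have hbc' : b < c := by simpa using hbc
        have hcb' : σ c < σ b := by simpa using hcb
        induction a using Fin.succAboveCases j with
        | x =>
          rw [Fin.lt_succAbove_iff_le_castSucc] at hab
          exact lt_asymm hcb' (hm b c hab hbc')
        | p a => exact h a b c (by simpa using hab) hbc' ⟨by simpa using hba, hcb'⟩

theorem ldes_insertMax_last (σ : Equiv.Perm (Fin n)) :
    ldes (insertMax σ (Fin.last n)) = ldes σ := by
  have hc : ∀ i : Fin n, insertMax σ (Fin.last n) i.castSucc = (σ i).castSucc := fun i => by
    rw [← Fin.succAbove_last_apply, insertMax_succAbove]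
  refine eq_of_forall_ge_iff fun k => ?_
  rw [ldes_le_iff_lt, ldes_le_iff_lt]
  constructor
  · intro h a b hka hab
    have := h a.castSucc b.castSucc hka (by simpa)
    rwa [hc, hc, Fin.castSucc_lt_castSucc_iff] at this
  · intro h a b hka hab
    induction b using Fin.lastCases with
    | last =>
      rw [insertMax_self, Fin.lt_last_iff_ne_last]
      exact fun he => hab.ne ((insertMax σ (Fin.last n)).injective
        (he.trans (insertMax_self σ _).symm))
    | cast b =>
      induction a using Fin.lastCases with
      | last => exact absurd hab (Fin.le_last _).not_gt
      | cast a =>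
        rw [hc, hc, Fin.castSucc_lt_castSucc_iff]
        exact h a b hka (by simpa using hab)

theorem ldes_insertMax_castSucc (σ : Equiv.Perm (Fin n)) (j : Fin n) (hj : ldes σ ≤ j.val) :
    ldes (insertMax σ j.castSucc) = j.val + 1 := by
  apply le_antisymm
  · rw [ldes_le_iff_lt] at hj ⊢
    intro a b hja hab
    have hja' : j.castSucc < a := Fin.lt_def.mpr hja
    have hs : ∀ x : Fin (n + 1), j.castSucc < x →
        ∃ y : Fin n, j ≤ y ∧ x = j.castSucc.succAbove y := by
      intro x hx
      obtain ⟨y, rfl⟩ := Fin.exists_succAbove_eq hx.ne'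
      rw [Fin.lt_succAbove_iff_le_castSucc] at hx
      exact ⟨y, hx, rfl⟩
    obtain ⟨a, ha, rfl⟩ := hs a hja'
    obtain ⟨b, hb, rfl⟩ := hs b (hja'.trans hab)
    rw [insertMax_succAbove, insertMax_succAbove, Fin.castSucc_lt_castSucc_iff]
    exact hj a b ha (by simpa using hab)
  · by_contra hlt
    have hle : ldes (insertMax σ j.castSucc) ≤ j.val := by omega
    have := (ldes_le_iff _ j.val).mp hle j.castSucc j.succ le_rfl (by simp)
    rw [insertMax_self] at this
    exact absurd this (Fin.le_last _).not_gt

theorem sum_T_succ {M : Type*} [AddCommMonoid M] (f : Equiv.Perm (Fin (n + 1)) → M) :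
    ∑ π ∈ T (n + 1), f π =
      ∑ σ ∈ T n, ∑ j : Fin (n + 1), if ldes σ ≤ j.val then f (insertMax σ j) else 0 := by
  simp only [T, sum_filter]
  rw [← insertMax_bijective.sum_comp, Fintype.sum_prod_type]
  refine sum_congr rfl fun σ _ => ?_
  simp only [avoids321_insertMax]
  by_cases h : Avoids321 σ <;> simp [h]

/-! ### Recurrence for the counts by last descent -/

/-- The number of `321`-avoiding permutations with last descent `m`, each weighted by the value
of the character `c` at its sign. -/
def weight (c : ℤˣ →* ℤ) (n m : ℕ) : ℤ :=
  ∑ π ∈ T n, if ldes π = m then c (Equiv.Perm.sign π) else 0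

theorem sum_range_weight (c : ℤˣ →* ℤ) (n m : ℕ) :
    ∑ k ∈ range m, weight c n k =
      ∑ π ∈ T n, if ldes π < m then c (Equiv.Perm.sign π) else 0 := by
  simp only [weight]
  rw [sum_comm]
  refine sum_congr rfl fun π _ => ?_
  rw [sum_ite_eq]
  simp

theorem weight_succ (c : ℤˣ →* ℤ) {n m : ℕ} (hm : m ≤ n) :
    weight c (n + 1) m =
      weight c n m + c ((-1) ^ (n + m + 1)) * ∑ k ∈ range m, weight c n k := by
  rw [sum_range_weight, weight, sum_T_succ, weight, mul_sum, ← sum_add_distrib]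
  refine sum_congr rfl fun σ hσ => ?_
  have hlast : ldes σ ≤ n := by
    rw [ldes_le_iff]
    intro a _ ha
    omega
  rw [Fin.sum_univ_castSucc, Fin.val_last, if_pos hlast, ldes_insertMax_last, sign_insertMax,
    Fin.val_last, ← two_mul, pow_mul, neg_one_sq, one_pow, one_mul, add_comm]
  congr 1
  -- Among the non-final positions only `j = m - 1` yields last descent `m`.
  have hterm : ∀ j : Fin n,
      (if ldes σ ≤ j.castSucc.val then
        (if ldes (insertMax σ j.castSucc) = m then
          c (Equiv.Perm.sign (insertMax σ j.castSucc)) else 0) else 0) =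
      if j.val + 1 = m then
        c ((-1) ^ (n + m + 1)) * (if ldes σ < m then c (Equiv.Perm.sign σ) else 0) else 0 := by
    intro j
    by_cases hj : ldes σ ≤ j.val
    · rw [if_pos (by simpa using hj), ldes_insertMax_castSucc σ j hj]
      by_cases hjm : j.val + 1 = m
      · rw [if_pos hjm, if_pos hjm, if_pos (by omega), sign_insertMax, map_mul, ← hjm]
        congr 2
        rw [Fin.val_castSucc, show n + (j.val + 1) + 1 = n + j.val + 2 by omega, pow_add _ _ 2,
          neg_one_sq, mul_one]
      · rw [if_neg hjm, if_neg hjm]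
    · rw [if_neg (by simpa using hj)]
      by_cases hjm : j.val + 1 = m
      · rw [if_pos hjm, if_neg (by omega), mul_zero]
      · rw [if_neg hjm]
  rw [sum_congr rfl fun j _ => hterm j]
  rcases m with _ | m
  · simp
  · rw [sum_eq_single (⟨m, hm⟩ : Fin n)]
    · simp
    · intro b _ hb
      rw [if_neg]
      intro h
      exact hb (Fin.ext (by simpa using h))
    · simp

theorem weight_eq_zero (c : ℤˣ →* ℤ) {n m : ℕ} (hm : n < m) : weight c (n + 1) m = 0 :=
  sum_eq_zero fun π _ => if_neg (by have := ldes_lt_succ π; omega)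

theorem weight_zero (c : ℤˣ →* ℤ) (m : ℕ) : weight c 0 m = if m = 0 then 1 else 0 := by
  have hl : ∀ π : Equiv.Perm (Fin 0), ldes π = 0 := fun π =>
    Nat.le_zero.mp ((ldes_le_iff π 0).mpr fun a => a.elim0)
  have hT : T 0 = {1} := by
    ext π
    simp [T, Avoids321, Subsingleton.elim π 1]
  simp [weight, hT, hl, eq_comm]

theorem weight_one (c : ℤˣ →* ℤ) (m : ℕ) : weight c 1 m = if m = 0 then 1 else 0 := by
  rcases m with _ | m
  · rw [weight_succ c le_rfl, weight_zero]
    simp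
  · rw [weight_eq_zero c (Nat.succ_pos m), if_neg (Nat.succ_ne_zero m)]

/-- The number of `321`-avoiding permutations with last descent `m`. -/
abbrev count : ℕ → ℕ → ℤ := weight 1

/-- The sum of the signs of the `321`-avoiding permutations with last descent `m`. -/
abbrev signedCount : ℕ → ℕ → ℤ := weight (Units.coeHom ℤ)

theorem count_succ {n m : ℕ} (hm : m ≤ n) :
    count (n + 1) m = ∑ k ∈ range (m + 1), count n k := by
  rw [count, weight_succ 1 hm, sum_range_succ, MonoidHom.one_apply, one_mul, add_comm]

theorem signedCount_succ {n m : ℕ} (hm : m ≤ n) :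
    signedCount (n + 1) m =
      signedCount n m + (-1) ^ (n + m + 1) * ∑ k ∈ range m, signedCount n k := by
  rw [signedCount, weight_succ _ hm]
  simp

/-! ### Signed counts at odd and even lengths -/

theorem sum_range_two_mul {M : Type*} [AddCommMonoid M] (f : ℕ → M) (m : ℕ) :
    ∑ k ∈ range (2 * m), f k = ∑ k ∈ range m, (f (2 * k) + f (2 * k + 1)) := by
  induction m with
  | zero => simp
  | succ m ih => rw [mul_add, mul_one, sum_range_succ, sum_range_succ, ih, sum_range_succ, add_assoc]

theorem signedCount_even_of_odd {n : ℕ}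
    (h : ∀ m, signedCount (2 * n + 1) (2 * m) = count n m ∧
      signedCount (2 * n + 1) (2 * m + 1) = 0) (m : ℕ) :
    signedCount (2 * n + 2) (2 * m) = count (n + 1) m ∧
      signedCount (2 * n + 2) (2 * m + 1) = -count (n + 1) m := by
  have hs : ∑ k ∈ range (2 * m), signedCount (2 * n + 1) k = ∑ k ∈ range m, count n k := by
    rw [sum_range_two_mul]
    exact sum_congr rfl fun k _ => by rw [(h k).1, (h k).2, add_zero]
  rcases le_or_gt m n with hm | hm
  · constructor
    · rw [signedCount_succ (by omega), hs, (h m).1, count_succ hm, sum_range_succ,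
        Even.neg_one_pow ⟨n + m + 1, by ring⟩, one_mul, add_comm]
    · rw [signedCount_succ (by omega), sum_range_succ, hs, (h m).1, (h m).2, count_succ hm,
        sum_range_succ, Odd.neg_one_pow ⟨n + m + 1, by ring⟩, zero_add, neg_one_mul]
  · rw [count, weight_eq_zero _ hm, signedCount, weight_eq_zero _ (by omega),
      weight_eq_zero _ (by omega)]
    simp

theorem signedCount_odd_of_even {n : ℕ}
    (h : ∀ m, signedCount (2 * n + 2) (2 * m) = count (n + 1) m ∧
      signedCount (2 * n + 2) (2 * m + 1) = -count (n + 1) m) (m : ℕ) :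
    signedCount (2 * n + 3) (2 * m) = count (n + 1) m ∧
      signedCount (2 * n + 3) (2 * m + 1) = 0 := by
  have hs : ∑ k ∈ range (2 * m), signedCount (2 * n + 2) k = 0 := by
    rw [sum_range_two_mul]
    exact sum_eq_zero fun k _ => by rw [(h k).1, (h k).2, add_neg_cancel]
  constructor
  · rcases le_or_gt m (n + 1) with hm | hm
    · rw [signedCount_succ (by omega), hs, (h m).1, mul_zero, add_zero]
    · rw [count, weight_eq_zero _ (by omega), signedCount, weight_eq_zero _ (by omega)]
  · rcases le_or_gt m n with hm | hm
    · rw [signedCount_succ (by omega), sum_range_succ, hs, (h m).1, (h m).2,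
        Even.neg_one_pow ⟨n + m + 2, by ring⟩, zero_add, one_mul, neg_add_cancel]
    · rw [signedCount, weight_eq_zero _ (by omega)]

theorem signedCount_odd (n m : ℕ) :
    signedCount (2 * n + 1) (2 * m) = count n m ∧ signedCount (2 * n + 1) (2 * m + 1) = 0 := by
  induction n generalizing m with
  | zero => simp [weight_one, weight_zero]
  | succ n ih => exact signedCount_odd_of_even (signedCount_even_of_odd ih) m

/-! ### Comparison of coefficients -/

theorem coeff_sum_X_pow_two_mul_ldes (n m : ℕ) :
    (∑ π ∈ T n, (Polynomial.X : Polynomial ℤ) ^ (2 * ldes π)).coeff (2 * m) = count n m ∧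
    (∑ π ∈ T n, (Polynomial.X : Polynomial ℤ) ^ (2 * ldes π)).coeff (2 * m + 1) = 0 := by
  simp only [Polynomial.finsetSum_coeff, Polynomial.coeff_X_pow, count, weight]
  constructor
  · refine sum_congr rfl fun π _ => ?_
    rw [MonoidHom.one_apply]
    exact if_congr (by omega) rfl rfl
  · exact sum_eq_zero fun π _ => if_neg (by omega)

theorem coeff_sum_sign_mul_X_pow_ldes (n m : ℕ) :
    (∑ π ∈ T n, Polynomial.C ((Equiv.Perm.sign π : ℤˣ) : ℤ) * Polynomial.X ^ ldes π).coeff m =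
      signedCount n m := by
  simp only [Polynomial.finsetSum_coeff, Polynomial.coeff_C_mul_X_pow, signedCount, weight]
  exact sum_congr rfl fun π _ => if_congr eq_comm rfl rfl

end SignBalance

theorem theorem4p1 (n : ℕ) (hn : 1 ≤ n) :
    (∑ π ∈ SignBalance.T (2 * n + 1),
        Polynomial.C ((Equiv.Perm.sign π : ℤˣ) : ℤ) * Polynomial.X ^ SignBalance.ldes π
      = ∑ π ∈ SignBalance.T n, (Polynomial.X : Polynomial ℤ) ^ (2 * SignBalance.ldes π)) ∧
    (∑ π ∈ SignBalance.T (2 * n),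
        Polynomial.C ((Equiv.Perm.sign π : ℤˣ) : ℤ) * Polynomial.X ^ SignBalance.ldes π
      = (1 - Polynomial.X) *
          ∑ π ∈ SignBalance.T n, (Polynomial.X : Polynomial ℤ) ^ (2 * SignBalance.ldes π)) := by
  open SignBalance in
  constructor
  · ext k
    rw [coeff_sum_sign_mul_X_pow_ldes]
    obtain ⟨m, rfl | rfl⟩ := Nat.even_or_odd' k
    · rw [(signedCount_odd n m).1, (coeff_sum_X_pow_two_mul_ldes n m).1]
    · rw [(signedCount_odd n m).2, (coeff_sum_X_pow_two_mul_ldes n m).2]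
  -- Even length `2 * n + 2` is reached from odd length `2 * n + 1`; at length 0 the identity would
  -- read `1 = 1 - X`.
  · obtain ⟨n, rfl⟩ := Nat.exists_eq_add_of_le' hn
    have he := signedCount_even_of_odd (signedCount_odd n)
    ext k
    rw [coeff_sum_sign_mul_X_pow_ldes, sub_mul, one_mul, Polynomial.coeff_sub]
    obtain ⟨m, rfl | rfl⟩ := Nat.even_or_odd' k
    · rw [mul_add, mul_one, (he m).1, (coeff_sum_X_pow_two_mul_ldes _ m).1]
      rcases m with _ | m
      · simp
      · rw [show 2 * (m + 1) = 2 * m + 1 + 1 by ring, Polynomial.coeff_X_mul,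
          (coeff_sum_X_pow_two_mul_ldes _ m).2, sub_zero]
    · rw [mul_add, mul_one, (he m).2, Polynomial.coeff_X_mul,
        (coeff_sum_X_pow_two_mul_ldes _ m).1, (coeff_sum_X_pow_two_mul_ldes _ m).2, zero_sub]
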